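/- **Setting.** Fix $U\in\mathbb N$ and let $\Delta^U=\{\mathbf q\in\mathbb R^{U+1}:\sum_{i=0}^U q_i=1,\ q_i\ge 0\}$ be the simplex of notification profiles, where $q_i$ is the fraction of riders that are notified to exactly $i$ drivers. Fix arrival rates $\lambda,\tilde\lambda>0$ of riders and drivers, a response rate $\mu>0$, an acceptance probability $p\in[0,1]$, a rider abandonment rate $\eta>0$, and departure rates $\tilde\eta_I>0$, $\tilde\eta_N\ge 0$ of idle and notified drivers, such that $c:=\mu(1-p)+\tilde\eta_N>0$. Put $\Pi_a^b=\prod_{j=a}^b\frac{jc}{\eta+j(\mu+\tilde\eta_N)}$ (empty products are $1$). **Fluid stage.** For $\mathbf q\in\Delta^U$ let $$R_0(\mathbf q)=\frac{\lambda}{\eta+\sum_{i=1}^U q_i(1-\Pi_1^i)} .$$ Under the first-accept protocol, let $$D_0(\mathbf q)=\frac1{\tilde\eta_I}\left(\tilde\lambda-(\mu p+\tilde\eta_N)\,\frac{\frac{\lambda}{c}\sum_{\ell=1}^U\sum_{i=\ell}^U q_i\Pi_\ell^i}{\eta+\sum_{i=1}^U q_i(1-\Pi_1^i)}\right).$$ Under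 the best-accept protocol, let $$D_0(\mathbf q)=\frac{1}{\tilde\eta_I}\left(\tilde\lambda+\sum_{\ell=1}^U D_\ell\bigl(\eta+\mu(1-p)+(\ell-1)\mu p\bigr)+\sum_{\ell=2}^U A_\ell\bigl(\eta+(\ell-1)\mu p\bigr)-R_0\sum_{\ell=1}^U\ell q_\ell\right),$$ where $$D_\ell=R_0\sum_{j=\ell}^U\frac{\Pi_\ell^j\sum_{i=j}^U q_i}{jc},\qquad A_\ell=R_0\left(\frac{\sum_{i=\ell-1}^U q_i(1-\Pi_\ell^i)}{\eta+(\ell-1)(\tilde\eta_N+\mu)}-\sum_{j=\ell}^U\frac{\eta+(\ell-1)\mu p}{\eta+(\ell-1)(\tilde\eta_N+\mu)}\cdot\frac{\Pi_\ell^j\sum_{i=j}^U q_i}{jc}\right).$$ **Simulation stage.** Fix one of the two protocols, a (possibly randomized, measurable) packing algorithm, and a number $K\ge 1$ of instances. The algorithm receives the matrix of scores of a market with $m$ riders and $n$ drivers, and returns pairwise disjoint sets of notified drivers, one for each rider, each with at most $U$ elements. Given real market sizes $(R_0,D_0)$, round each of them independently to a nonnegative integer: $x\ge0$ becomes $\lceil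 x\rceil$ with probability $x-\lfloor x\rfloor$ and $\lfloor x\rfloor$ otherwise, and $x<0$ becomes $0$. Let $(m,n)$ be the result. Sample $K$ independent instances with $m$ riders and $n$ drivers located in the plane, all coordinates being independent standard normal variables, where a rider-driver pair at Euclidean distance $d$ has score $1/(1+d)$, and run the algorithm on each. The empirical frequency vector has as its $i$-th entry ($0\le i\le U$) the fraction, among the $Km$ sampled riders, of those who are notified to exactly $i$ drivers; if $m=0$, it is a fixed profile $\mathbf q^{\varnothing}\in\Delta^U$, chosen arbitrarily in advance. Let $\mathbf q'$ be the expectation of the empirical frequency vector, over the rounding, the locations and the randomness of the algorithm. **Theorem.** The composite map $F:\mathbf q\mapsto(R_0(\mathbf q),D_0(\mathbf q))\mapsto\mathbf q'$ maps $\Delta^U$ into itself and has a fixed point: there is $\mathbf q^*\in\Delta^U$ with $F(\mathbf q^*)=\mathbf q^*$. Moreover, $\mathbf q^*$ can be chosen with $R_0(\mathbf q^*)>0$ and such that $D_0(\mathbf q^*)>0$ whenever $R_0(\mathbf q^*)\ge 1$ or $\mathbf q^{\varnothing}=(1,0,\dots,0)$. -/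

import Mathlib

open MeasureTheory ProbabilityTheory Finset

noncomputable section

namespace NED

/-! ### Fluid model -/

/-- Contention resolution: first-accept or best-accept. -/
inductive Protocol where
  | firstAccept
  | bestAccept

/-- The rates of the fluid model: `lam`, `lamD` are the arrival rates of riders and drivers, `mu` the
response rate of a notified driver, `p` the acceptance probability, `eta` the abandonment rate of
riders, `etaI` and `etaN` the departure rates of idle and of notified drivers. -/
structure Params where
  lam : ℝ
  lamD : ℝ
  mu : ℝ
  p : ℝ
  eta : ℝ
  etaI : ℝ
  etaN : ℝ

/-- Admissible rates. The last field says that a notified driver can leave the notified state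
without accepting; this is the quantity by which the closed forms divide. -/
structure Params.Admissible (P : Params) : Prop where
  lam_pos : 0 < P.lam
  lamD_pos : 0 < P.lamD
  mu_pos : 0 < P.mu
  p_nonneg : 0 ≤ P.p
  p_le_one : P.p ≤ 1
  eta_pos : 0 < P.eta
  etaI_pos : 0 < P.etaI
  etaN_nonneg : 0 ≤ P.etaN
  reject_pos : 0 < P.mu * (1 - P.p) + P.etaN

/-- Notification profiles `(q_0, …, q_U)`; the simplex is `stdSimplex ℝ (Fin (U + 1))`. -/
abbrev Profile (U : ℕ) := Fin (U + 1) → ℝ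

/-- The entry `q_i`, for a natural number `i` (zero if `i > U`). -/
def Profile.entry {U : ℕ} (q : Profile U) (i : ℕ) : ℝ :=
  if h : i < U + 1 then q ⟨i, h⟩ else 0

/-- The profile under which no rider is notified to any driver: `q_0 = 1`. -/
def Profile.idle (U : ℕ) : Profile U := Pi.single 0 1

namespace Params

variable (P : Params)

/-- `μ(1-p) + η_N`. -/
def c : ℝ := P.mu * (1 - P.p) + P.etaN

/-- `∏_{j=a}^{b} j (μ(1-p)+η_N) / (η + j (μ+η_N))`; the empty product is one. -/
def ratioProd (a b : ℕ) : ℝ :=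
  ∏ j ∈ Icc a b, ((j : ℝ) * P.c / (P.eta + (j : ℝ) * (P.mu + P.etaN)))

variable {U : ℕ} (q : Profile U)

/-- `η + ∑_{i=1}^U q_i (1 - ∏_{j=1}^i …)`. -/
def exitRate : ℝ :=
  P.eta + ∑ i ∈ Icc 1 U, q.entry i * (1 - P.ratioProd 1 i)

/-- The mass `R_0` of riders awaiting notification (the same formula under both protocols). -/
def R0 : ℝ := P.lam / P.exitRate q

/-- The mass `D_0` of idle drivers under first-accept. -/
def D0FA : ℝ :=
  (P.lamD - (P.mu * P.p + P.etaN) *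
    ((P.lam / P.c * ∑ l ∈ Icc 1 U, ∑ i ∈ Icc l U, q.entry i * P.ratioProd l i)
      / P.exitRate q)) / P.etaI

/-- The mass `A_l` of riders in the `l`-th accepted state under best-accept, `2 ≤ l ≤ U`; it is
also the mass of drivers in the `l`-th accepted state. -/
def ABA (l : ℕ) : ℝ :=
  P.R0 q *
    ((∑ i ∈ Icc (l - 1) U, q.entry i * (1 - P.ratioProd l i))
        / (P.eta + ((l : ℝ) - 1) * (P.etaN + P.mu))
      - ∑ j ∈ Icc l U,
          ((P.eta + ((l : ℝ) - 1) * P.mu * P.p) / (P.eta + ((l : ℝ) - 1) * (P.etaN + P.mu))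
              * P.ratioProd l j * ∑ i ∈ Icc j U, q.entry i)
            / ((j : ℝ) * P.c))

/-- The mass `D_l` of notified drivers of rank `l` under best-accept, `1 ≤ l ≤ U`. -/
def DBA (l : ℕ) : ℝ :=
  P.R0 q * ∑ j ∈ Icc l U,
    (P.ratioProd l j * ∑ i ∈ Icc j U, q.entry i) / ((j : ℝ) * P.c)

/-- The mass `D_0` of idle drivers under best-accept. -/
def D0BA : ℝ :=
  (P.lamD
    + ∑ l ∈ Icc 1 U,
        P.DBA q l * (P.eta + P.mu * (1 - P.p) + ((l : ℝ) - 1) * P.mu * P.p)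
    + ∑ l ∈ Icc 2 U, P.ABA q l * (P.eta + ((l : ℝ) - 1) * P.mu * P.p)
    - P.R0 q * ∑ l ∈ Icc 1 U, (l : ℝ) * q.entry l) / P.etaI

/-- The mass `D_0` of idle drivers. -/
def D0 (prot : Protocol) : ℝ :=
  match prot with
  | .firstAccept => P.D0FA q
  | .bestAccept => P.D0BA q

end Params

/-! ### Simulation environment -/

/-- Notification sets of a single cycle with `m` riders and `n` drivers: every rider is notified to
at most `U` drivers and no driver receives two notifications. -/
def Packing (U m n : ℕ) : Type :=
  {S : Fin m → Finset (Fin n) // Pairwise (fun r r' => Disjoint (S r) (S r')) ∧ ∀ r, #(S r) ≤ U}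

instance (U m n : ℕ) : MeasurableSpace (Packing U m n) := ⊤

/-- A (possibly randomized) packing algorithm: for each market size, it chooses notification sets
given the matrix of scores of the rider-driver pairs. -/
structure DispatchAlgorithm (U : ℕ) where
  toKernel : ∀ m n : ℕ, Kernel (Fin m → Fin n → ℝ) (Packing U m n)
  isMarkov : ∀ m n : ℕ, IsMarkovKernel (toKernel m n)

abbrev Plane := EuclideanSpace ℝ (Fin 2)

/-- Locations of `m` riders and `n` drivers, independent with standard normal coordinates. -/
def snapshotLaw (m n : ℕ) : Measure ((Fin m → Plane) × (Fin n → Plane)) :=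
  (Measure.pi fun _ => stdGaussian Plane).prod (Measure.pi fun _ => stdGaussian Plane)

/-- The score of a pair at Euclidean distance `d` is `1 / (1 + d)`. -/
def score {m n : ℕ} (x : (Fin m → Plane) × (Fin n → Plane)) (r : Fin m) (d : Fin n) : ℝ :=
  1 / (1 + dist (x.1 r) (x.2 d))

/-- The law of the notification sets in one sampled instance with `m` riders and `n` drivers. -/
def outcomeLaw {U : ℕ} (alg : DispatchAlgorithm U) (m n : ℕ) : Measure (Packing U m n) :=
  ((snapshotLaw m n).map score).bind (alg.toKernel m n)

/-- The number of riders that are notified to exactly `i` drivers. -/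
def Packing.count {U m n : ℕ} (S : Packing U m n) (i : Fin (U + 1)) : ℕ :=
  #{r : Fin m | #(S.1 r) = (i : ℕ)}

/-- The empirical frequency vector over `K` instances with `m` riders and `n` drivers each. If there
are no riders, the profile `qe` is reported. -/
def empiricalFreq {U m n K : ℕ} (qe : Profile U) (ω : Fin K → Packing U m n) : Profile U :=
  fun i => if m = 0 then qe i else (∑ k, ((ω k).count i : ℝ)) / ((K : ℝ) * (m : ℝ))

/-- The expected empirical frequency vector over `K` independent instances with `m` riders and `n`
drivers each. -/
def expectedFreq {U : ℕ} (alg : DispatchAlgorithm U) (K : ℕ) (qe : Profile U) (m n : ℕ) :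
    Profile U :=
  fun i => ∫ ω, empiricalFreq qe ω i ∂(Measure.pi fun _ : Fin K => outcomeLaw alg m n)

/-- Probabilistic rounding: `x` becomes `⌈x⌉` with probability `x - ⌊x⌋`, and `⌊x⌋` otherwise.
Negative values are replaced by zero (`⌈x⌉₊ = ⌊x⌋₊ = 0` for `x ≤ 0`). -/
def roundLaw (x : ℝ) : Measure ℕ :=
  ENNReal.ofReal (Int.fract x) • Measure.dirac ⌈x⌉₊
    + ENNReal.ofReal (1 - Int.fract x) • Measure.dirac ⌊x⌋₊

/-- The expected empirical profile produced by the simulator from real market sizes `x` (riders) and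
`y` (drivers), which are rounded independently. -/
def simulate {U : ℕ} (alg : DispatchAlgorithm U) (K : ℕ) (qe : Profile U) (x y : ℝ) : Profile U :=
  fun i => ∫ s : ℕ × ℕ, expectedFreq alg K qe s.1 s.2 i ∂((roundLaw x).prod (roundLaw y))

/-- One iteration of the procedure: from the assumed profile to the market sizes, and from these to
the expected empirical profile. -/
def iterMap {U : ℕ} (P : Params) (prot : Protocol) (alg : DispatchAlgorithm U) (K : ℕ)
    (qe : Profile U) (q : Profile U) : Profile U :=
  simulate alg K qe (P.R0 q) (P.D0 q prot)

end NED

end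

/-!
Rounding the market sizes at random is what makes a fixed point possible: between consecutive
integers the expected profile is an affine function of each real market size, and the pieces agree
at the integers, so the composite map is continuous on the simplex and Brouwer's theorem applies.
If `D_0 ≤ 0` at a fixed point, every sampled instance has no drivers and hence no notified rider.
Under either alternative of the positivity claim this forces the fixed point to be the idle profile;
but there `D_0 = λ̃ / η̃_I > 0`.

Brouwer's theorem is obtained by Milnor's volume argument. If `r` is a `C¹` retraction of a ball
onto its boundary and `g = r - id`, then `∫ det (id + t Dg)` over the ball is a polynomial in `t`.
For small `t` it equals the volume of the ball, because `id + t g` is then a bijection of the ball,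
so it does for `t = 1` too; but `det Dr = 0` since `r` has constant norm.
-/

/-! ### Brouwer's fixed point theorem -/

namespace Brouwer

open Polynomial in
theorem eval_eq_sum_eval_lagrangeBasis_mul {F ι : Type*} [Field F] [DecidableEq ι] {s : Finset ι}
    {v : ι → F} (hv : Set.InjOn v s) {p : F[X]} (hp : p.degree < #s) (x : F) :
    p.eval x = ∑ i ∈ s, (Lagrange.basis s v i).eval x * p.eval (v i) := by
  conv_lhs => rw [Lagrange.eq_interpolate hv hp]
  simp only [Lagrange.interpolate_apply, eval_finsetSum, eval_mul, eval_C, mul_comm]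

section IdAdd

variable {E : Type*} [NormedAddCommGroup E] [NormedSpace ℝ E]

open Polynomial in
theorem exists_polynomial_eval_eq_det_id_add_smul [FiniteDimensional ℝ E] (A : E →L[ℝ] E) :
    ∃ p : ℝ[X], p.natDegree ≤ Module.finrank ℝ E ∧
      ∀ t : ℝ, p.eval t = (ContinuousLinearMap.id ℝ E + t • A).det := by
  let b := Module.finBasis ℝ E
  let M := LinearMap.toMatrix b b (A : E →ₗ[ℝ] E)
  refine ⟨((X : ℝ[X]) • M.map C + (1 : Matrix _ _ ℝ).map C).det, ?_, fun t => ?_⟩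
  · simpa only [Fintype.card_fin] using natDegree_det_X_add_C_le M 1
  · rw [← coe_evalRingHom, RingHom.map_det, ContinuousLinearMap.det, ← LinearMap.det_toMatrix b]
    congr 1
    ext i j
    simp [M, LinearMap.toMatrix_apply, Matrix.one_apply, Finsupp.single_apply, add_comm, eq_comm,
      apply_ite (eval t), mul_comm t]

theorem det_id_add_ne_zero [CompleteSpace E] {A : E →L[ℝ] E} (hA : ‖A‖ < 1) :
    (ContinuousLinearMap.id ℝ E + A).det ≠ 0 := by
  have hunit : IsUnit (1 - -A) := isUnit_one_sub_of_norm_lt_one (by rwa [norm_neg])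
  rw [sub_neg_eq_add] at hunit
  exact ((hunit.map ContinuousLinearMap.toLinearMapRingHom).map LinearMap.det).ne_zero

theorem det_id_add_pos [FiniteDimensional ℝ E] {A : E →L[ℝ] E} (hA : ‖A‖ < 1) :
    0 < (ContinuousLinearMap.id ℝ E + A).det := by
  have hcomplete := FiniteDimensional.complete ℝ E
  have hne : ∀ s ∈ Set.Icc (0 : ℝ) 1, (ContinuousLinearMap.id ℝ E + s • A).det ≠ 0 := by
    refine fun s hs => det_id_add_ne_zero ?_
    rw [norm_smul, Real.norm_of_nonneg hs.1]
    exact (mul_le_of_le_one_left (norm_nonneg A) hs.2).trans_lt hA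
  have hcont : Continuous fun s : ℝ => (ContinuousLinearMap.id ℝ E + s • A).det :=
    ContinuousLinearMap.continuous_det.comp (by fun_prop)
  by_contra! hle
  obtain ⟨s, hs, hs0⟩ := intermediate_value_Icc' zero_le_one hcont.continuousOn
    (show (0 : ℝ) ∈ _ by simpa [ContinuousLinearMap.det] using hle)
  exact hne s hs hs0

variable {g : E → E} {K : NNReal}

theorem bijective_id_add [CompleteSpace E] (hg : LipschitzWith K g) (hK : K < 1) :
    Function.Bijective fun x => x + g x := by
  have happrox : ApproximatesLinearOn (fun x => x + g x)
      (ContinuousLinearEquiv.refl ℝ E : E →L[ℝ] E) Set.univ K := by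
    rw [ApproximatesLinearOn.approximatesLinearOn_iff_lipschitzOnWith, lipschitzOnWith_univ]
    convert hg using 1
    ext x
    simp
  have hsmall : Subsingleton E ∨
      K < ‖((ContinuousLinearEquiv.refl ℝ E).symm : E →L[ℝ] E)‖₊⁻¹ := by
    refine (subsingleton_or_nontrivial E).imp_right fun hE : Nontrivial E => ?_
    rwa [ContinuousLinearEquiv.refl_symm, ContinuousLinearEquiv.coe_refl,
      ContinuousLinearMap.nnnorm_id, inv_one]
  exact ⟨Set.injOn_univ.1 (happrox.injOn hsmall), happrox.surjective hsmall⟩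

theorem image_id_add_eq [CompleteSpace E] (hg : LipschitzWith K g) (hK : K < 1) {s : Set E}
    (hs : ∀ x ∉ s, g x = 0) : (fun x => x + g x) '' s = s := by
  have hbij := bijective_id_add hg hK
  have hcompl : (fun x => x + g x) '' sᶜ = sᶜ :=
    (Set.image_congr fun x hx => by rw [hs x hx, add_zero]).trans (Set.image_id' _)
  rwa [Set.image_compl_eq hbij, compl_inj_iff] at hcompl

section Volume

variable [FiniteDimensional ℝ E] [MeasurableSpace E] [BorelSpace E] {ν : Measure E}
  [ν.IsAddHaarMeasure] {s : Set E}

theorem integrableOn_det_and_setIntegral_det_of_lt_one (hg : LipschitzWith K g) (hK : K < 1)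
    (hs : IsOpen s) (hνs : ν s ≠ ⊤) (hg0 : ∀ x ∉ s, g x = 0)
    (hd : ∀ x ∈ s, DifferentiableAt ℝ g x) :
    IntegrableOn (fun x => (ContinuousLinearMap.id ℝ E + fderiv ℝ g x).det) s ν ∧
      ∫ x in s, (ContinuousLinearMap.id ℝ E + fderiv ℝ g x).det ∂ν = ν.real s := by
  have hcomplete := FiniteDimensional.complete ℝ E
  have hder : ∀ x ∈ s, HasFDerivWithinAt (fun x => x + g x)
      (ContinuousLinearMap.id ℝ E + fderiv ℝ g x) s x := fun x hx =>
    ((hasFDerivAt_id x).add (hd x hx).hasFDerivAt).hasFDerivWithinAt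
  have hinj := (bijective_id_add hg hK).injective.injOn (s := s)
  have habs : ∀ x, |(ContinuousLinearMap.id ℝ E + fderiv ℝ g x).det| • (1 : ℝ) =
      (ContinuousLinearMap.id ℝ E + fderiv ℝ g x).det := fun x => by
    rw [smul_eq_mul, mul_one, abs_of_pos]
    exact det_id_add_pos ((norm_fderiv_le_of_lipschitz ℝ hg).trans_lt (by exact_mod_cast hK))
  have hint := integrableOn_image_iff_integrableOn_abs_det_fderiv_smul ν hs.measurableSet hder
    hinj fun _ => (1 : ℝ)
  have heq := integral_image_eq_integral_abs_det_fderiv_smul ν hs.measurableSet hder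
    hinj fun _ => (1 : ℝ)
  simp only [image_id_add_eq hg hK hg0, habs] at hint heq
  exact ⟨hint.1 (integrableOn_const hνs), by simp [← heq]⟩

theorem setIntegral_det_id_add_fderiv (hg : LipschitzWith K g) (hs : IsOpen s) (hνs : ν s ≠ ⊤)
    (hg0 : ∀ x ∉ s, g x = 0) (hd : ∀ x ∈ s, DifferentiableAt ℝ g x) :
    ∫ x in s, (ContinuousLinearMap.id ℝ E + fderiv ℝ g x).det ∂ν = ν.real s := by
  -- Both sides agree for `t • g` with `t` small and are polynomials in `t`: extrapolate to `t = 1`.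
  let N := Module.finrank ℝ E + 1
  let t : ℕ → ℝ := fun i => (K + 1 + i : ℝ)⁻¹
  let w : ℕ → ℝ := fun i => (Lagrange.basis (range N) t i).eval 1
  have ht : Set.InjOn t (range N) := fun i _ j _ h => by simpa [t] using h
  have hw : ∑ i ∈ range N, w i = 1 := by
    have h := congrArg (Polynomial.eval 1) (Lagrange.sum_basis ht (by simp [N]))
    simpa only [Polynomial.eval_finsetSum, Polynomial.eval_one] using h
  have hextrapolate : ∀ A : E →L[ℝ] E, (ContinuousLinearMap.id ℝ E + A).det =
      ∑ i ∈ range N, w i * (ContinuousLinearMap.id ℝ E + t i • A).det := fun A => by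
    obtain ⟨p, hdeg, hp⟩ := exists_polynomial_eval_eq_det_id_add_smul A
    have hlt : p.degree < #(range N) := by
      rw [card_range]
      exact Polynomial.degree_le_natDegree.trans_lt (by exact_mod_cast Nat.lt_succ_of_le hdeg)
    simpa only [hp, one_smul] using eval_eq_sum_eval_lagrangeBasis_mul ht hlt 1
  have hsmall : ∀ i,
      IntegrableOn (fun x => (ContinuousLinearMap.id ℝ E + t i • fderiv ℝ g x).det) s ν ∧
      ∫ x in s, (ContinuousLinearMap.id ℝ E + t i • fderiv ℝ g x).det ∂ν = ν.real s := fun i => by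
    have htK : ‖t i‖₊ * K < 1 := by
      rw [← NNReal.coe_lt_coe, NNReal.coe_mul, coe_nnnorm, Real.norm_of_nonneg (by positivity),
        NNReal.coe_one, inv_mul_lt_one₀ (by positivity)]
      linarith [(Nat.cast_nonneg i : (0 : ℝ) ≤ i)]
    have hfd : t i • fderiv ℝ g = fderiv ℝ (t i • g) := (fderiv_const_smul_field (t i)).symm
    simp only [← Pi.smul_apply (t i) (fderiv ℝ g), hfd]
    exact integrableOn_det_and_setIntegral_det_of_lt_one
      ((lipschitzWith_smul (t i)).comp hg) htK hs hνs (fun x hx => by simp [hg0 x hx])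
      fun x hx => (hd x hx).const_smul (t i)
  rw [funext fun x => hextrapolate (fderiv ℝ g x)]
  rw [integral_finsetSum _ fun i _ => (hsmall i).1.const_mul (w i)]
  simp_rw [integral_const_mul, (hsmall _).2, ← Finset.sum_mul, hw, one_mul]

end Volume

end IdAdd

theorem lipschitzWith_of_eq_const_off_interior {E X : Type*} [NormedAddCommGroup E]
    [NormedSpace ℝ E] [PseudoMetricSpace X] {s : Set E} (hs : IsClosed s) {K : NNReal} {g : E → X}
    (hg : LipschitzOnWith K g s) {c : X} (hc : ∀ x ∉ interior s, g x = c) : LipschitzWith K g := by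
  have hmixed : ∀ x ∈ s, ∀ y ∉ s, dist (g x) (g y) ≤ K * dist x y := by
    intro x hx y hy
    obtain ⟨z, hzxy, hzs, hzi⟩ : ∃ z ∈ segment ℝ x y, z ∈ s ∧ z ∉ interior s := by
      by_contra! hmiss
      obtain ⟨z, -, hzi, hzs⟩ := (convex_segment (𝕜 := ℝ) x y).isPreconnected (interior s) sᶜ
        isOpen_interior hs.isOpen_compl (fun z hz => or_iff_not_imp_right.2 fun hzs =>
          hmiss z hz (not_not.1 hzs)) ⟨x, left_mem_segment ℝ x y,
          hmiss x (left_mem_segment ℝ x y) hx⟩ ⟨y, right_mem_segment ℝ x y, hy⟩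
      exact hzs (interior_subset hzi)
    calc dist (g x) (g y) = dist (g x) (g z) := by
          rw [hc y fun h => hy (interior_subset h), hc z hzi]
      _ ≤ K * dist x z := hg.dist_le_mul x hx z hzs
      _ ≤ K * dist x y := by
          gcongr
          exact (le_add_of_nonneg_right dist_nonneg).trans_eq (dist_add_dist_of_mem_segment hzxy)
  refine LipschitzWith.of_dist_le_mul fun x y => ?_
  by_cases hx : x ∈ s <;> by_cases hy : y ∈ s
  · exact hg.dist_le_mul x hx y hy
  · exact hmixed x hx y hy
  · simpa only [dist_comm] using hmixed y hy x hx
  · rw [hc x fun h => hx (interior_subset h), hc y fun h => hy (interior_subset h), dist_self]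
    positivity

theorem exists_lipschitzWith_indicator_of_contDiffAt {E F : Type*} [NormedAddCommGroup E]
    [NormedSpace ℝ E] [NormedAddCommGroup F] [NormedSpace ℝ F] {s : Set E} (hs : IsCompact s)
    {f : E → F} (hf : ∀ x ∈ s, ContDiffAt ℝ 1 f x) (hf0 : ∀ x ∈ frontier s, f x = 0) :
    ∃ K, LipschitzWith K (s.indicator f) := by
  obtain ⟨K, hK⟩ := LocallyLipschitzOn.exists_lipschitzOnWith_of_compact hs (f := f)
    fun x hx => by
      obtain ⟨K, t, ht, hKt⟩ := (hf x hx).exists_lipschitzOnWith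
      exact ⟨K, t, mem_nhdsWithin_of_mem_nhds ht, hKt⟩
  refine ⟨K, lipschitzWith_of_eq_const_off_interior hs.isClosed (c := 0) (fun x hx y hy => ?_)
    fun x hx => Set.indicator_apply_eq_zero.2 fun hxs => hf0 x ?_⟩
  · simpa only [Set.indicator_of_mem hx, Set.indicator_of_mem hy] using hK hx hy
  · rw [hs.isClosed.frontier_eq]
    exact ⟨hxs, hx⟩

section Ball

open Metric

variable {E : Type*} [NormedAddCommGroup E] [InnerProductSpace ℝ E] [FiniteDimensional ℝ E]
  {R : ℝ}

theorem det_fderiv_eq_zero_of_norm_eq {r : E → E} {x : E} (hr : DifferentiableAt ℝ r x)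
    (hR : 0 < R) (hnorm : ∀ᶠ y in nhds x, ‖r y‖ = R) : (fderiv ℝ r x).det = 0 := by
  have horth : ∀ v, inner ℝ (r x) (fderiv ℝ r x v) = 0 := fun v => by
    have hconst : HasFDerivAt (fun y => ‖r y‖ ^ 2) (0 : E →L[ℝ] ℝ) x :=
      (hasFDerivAt_const (R ^ 2) x).congr_of_eventuallyEq (hnorm.mono fun y hy => by simp [hy])
    simpa using DFunLike.congr_fun (hr.hasFDerivAt.norm_sq.unique hconst) v
  have hr0 : r x ≠ 0 := norm_pos_iff.1 (hnorm.self_of_nhds ▸ hR)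
  by_contra hdet
  obtain ⟨v, hv⟩ := (LinearMap.equivOfDetNeZero (fderiv ℝ r x : E →ₗ[ℝ] E) hdet).surjective (r x)
  have hv' : fderiv ℝ r x v = r x := hv
  exact hr0 (inner_self_eq_zero.1 (hv' ▸ horth v))

theorem exists_norm_ne_of_eq_id_on_sphere {r : E → E} (hR : 0 < R)
    (hr : ∀ x ∈ closedBall (0 : E) R, ContDiffAt ℝ 1 r x) (hid : ∀ x ∈ sphere (0 : E) R, r x = x) :
    ∃ x ∈ closedBall (0 : E) R, ‖r x‖ ≠ R := by
  borelize E
  by_contra! hnorm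
  let g : E → E := (closedBall 0 R).indicator fun x => r x - x
  have hr0 : ∀ x ∈ sphere (0 : E) R, r x - x = 0 := fun x hx => sub_eq_zero.2 (hid x hx)
  have hg0 : ∀ x ∉ ball (0 : E) R, g x = 0 := fun x hx => by
    refine Set.indicator_apply_eq_zero.2 fun hxc => hr0 x ?_
    rw [← closedBall_sdiff_ball]
    exact ⟨hxc, hx⟩
  obtain ⟨K, hK⟩ : ∃ K, LipschitzWith K g :=
    exists_lipschitzWith_indicator_of_contDiffAt (isCompact_closedBall 0 R)
      (fun x hx => (hr x hx).sub contDiffAt_id) (by rwa [frontier_closedBall _ hR.ne'])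
  have hgr : ∀ x ∈ ball (0 : E) R, HasFDerivAt g (fderiv ℝ r x - ContinuousLinearMap.id ℝ E) x :=
    fun x hx => by
      refine HasFDerivAt.congr_of_eventuallyEq (((hr x (ball_subset_closedBall hx)).differentiableAt
        one_ne_zero).hasFDerivAt.sub (hasFDerivAt_id x)) ?_
      filter_upwards [isOpen_ball.mem_nhds hx] with y hy
      exact Set.indicator_of_mem (ball_subset_closedBall hy) _
  have hdet : ∀ x ∈ ball (0 : E) R, (ContinuousLinearMap.id ℝ E + fderiv ℝ g x).det = 0 :=
    fun x hx => by
      rw [(hgr x hx).fderiv, add_sub_cancel]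
      refine det_fderiv_eq_zero_of_norm_eq ((hr x (ball_subset_closedBall hx)).differentiableAt
        one_ne_zero) hR ?_
      filter_upwards [isOpen_ball.mem_nhds hx] with y hy
      exact hnorm y (ball_subset_closedBall hy)
  have hvol := setIntegral_det_id_add_fderiv (ν := Measure.addHaar) hK isOpen_ball
    measure_ball_lt_top.ne hg0 fun x hx => (hgr x hx).differentiableAt
  rw [setIntegral_congr_fun measurableSet_ball hdet, integral_zero] at hvol
  exact (ENNReal.toReal_pos (measure_ball_pos _ _ hR).ne' measure_ball_lt_top.ne).ne hvol

theorem exists_eq_zero_of_eq_id_on_sphere {h : E → E} (hR : 0 < R) (hh : ContDiff ℝ 1 h)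
    (hid : ∀ x ∈ sphere (0 : E) R, h x = x) : ∃ x ∈ closedBall (0 : E) R, h x = 0 := by
  by_contra! hne
  obtain ⟨x, hx, hnorm⟩ := exists_norm_ne_of_eq_id_on_sphere (r := fun x => (R / ‖h x‖) • h x) hR
    (fun x hx => (contDiffAt_const.div (hh.contDiffAt.norm ℝ (hne x hx))
      (norm_ne_zero_iff.2 (hne x hx))).smul hh.contDiffAt) fun x hx => by
        rw [hid x hx, mem_sphere_zero_iff_norm.1 hx, div_self hR.ne', one_smul]
  refine hnorm ?_
  rw [norm_smul, norm_div, norm_norm, Real.norm_of_nonneg hR.le,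
    div_mul_cancel₀ _ (norm_ne_zero_iff.2 (hne x hx))]

theorem exists_fixedPoint_of_contDiff_of_norm_le {f : E → E} (hf : ContDiff ℝ 1 f)
    (hR : ∀ x, ‖f x‖ ≤ R) : ∃ x, f x = x := by
  have hR0 : 0 ≤ R := (norm_nonneg _).trans (hR 0)
  let χ : ContDiffBump (0 : E) := ⟨R + 1, R + 2, by positivity, by linarith⟩
  obtain ⟨x, -, hx⟩ := exists_eq_zero_of_eq_id_on_sphere (h := fun x => x - χ x • f x)
    (R := R + 2) (by positivity) (contDiff_id.sub (χ.contDiff.smul hf)) fun x hx => by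
      rw [χ.zero_of_le_dist (mem_sphere.1 hx).ge, zero_smul, sub_zero]
  have hxf : x = χ x • f x := sub_eq_zero.1 hx
  have hxR : ‖x‖ ≤ R := by
    rw [hxf, norm_smul, Real.norm_of_nonneg χ.nonneg]
    exact (mul_le_of_le_one_left (norm_nonneg _) χ.le_one).trans (hR x)
  have hχ : χ x = 1 := χ.one_of_mem_closedBall (by simpa [χ] using by linarith)
  rw [hχ, one_smul] at hxf
  exact ⟨x, hxf.symm⟩

theorem exists_fixedPoint_of_continuous_of_norm_le {f : E → E} (hf : Continuous f)
    (hR : ∀ x, ‖f x‖ ≤ R) : ∃ x, f x = x := by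
  have happrox : ∀ ε : ℝ, 0 < ε → ε ≤ 1 → ∃ x ∈ closedBall (0 : E) (R + 1), ‖f x - x‖ ≤ ε := by
    intro ε hε hε1
    obtain ⟨g, hg, hgf, -⟩ := hf.exists_contDiff_approx 1 continuous_const fun _ => hε
    have hgf' : ∀ x, ‖g x - f x‖ ≤ ε := fun x => (dist_eq_norm (g x) (f x)).ge.trans (hgf x).le
    have hgR : ∀ x, ‖g x‖ ≤ R + 1 := fun x => by
      linarith [norm_le_norm_add_norm_sub' (g x) (f x), hR x, hgf' x]
    obtain ⟨x, hx⟩ := exists_fixedPoint_of_contDiff_of_norm_le hg hgR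
    refine ⟨x, mem_closedBall_zero_iff.2 (hx ▸ hgR x), ?_⟩
    simpa only [hx, norm_sub_rev] using hgf' x
  obtain ⟨x, -, hmin⟩ := (isCompact_closedBall (0 : E) (R + 1)).exists_isMinOn
    (let ⟨y, hy, _⟩ := happrox 1 one_pos le_rfl; ⟨y, hy⟩) (f := fun x => ‖f x - x‖) (by fun_prop)
  have hle : ‖f x - x‖ ≤ 0 := le_of_forall_pos_le_add fun ε hε => by
    obtain ⟨y, hy, hyε⟩ := happrox (min ε 1) (by positivity) (min_le_right _ _)
    have hxy : ‖f x - x‖ ≤ ‖f y - y‖ := hmin hy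
    linarith [min_le_left ε 1]
  exact ⟨x, sub_eq_zero.1 (norm_le_zero_iff.1 hle)⟩

end Ball

theorem exists_retraction_of_convex {E : Type*} [NormedAddCommGroup E] [InnerProductSpace ℝ E]
    {s : Set E} (hne : s.Nonempty) (hcomplete : IsComplete s) (hconv : Convex ℝ s) :
    ∃ r : E → E, LipschitzWith 1 r ∧ (∀ x, r x ∈ s) ∧ ∀ x ∈ s, r x = x := by
  choose r hrs hrmin using exists_norm_eq_iInf_of_complete_convex hne hcomplete hconv
  have hobtuse : ∀ x, ∀ w ∈ s, inner ℝ (x - r x) (w - r x) ≤ 0 := fun x =>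
    (norm_eq_iInf_iff_real_inner_le_zero hconv (hrs x)).1 (hrmin x)
  refine ⟨r, LipschitzWith.of_dist_le_mul fun x y => ?_, hrs, fun x hx => ?_⟩
  · have hsq : ‖r x - r y‖ ^ 2 ≤ ‖x - y‖ * ‖r x - r y‖ :=
      calc ‖r x - r y‖ ^ 2 ≤ inner ℝ (x - y) (r x - r y) := by
            have hsum := add_nonpos (hobtuse x (r y) (hrs y)) (hobtuse y (r x) (hrs x))
            have hexpand : inner ℝ (x - r x) (r y - r x) + inner ℝ (y - r y) (r x - r y) =
                ‖r x - r y‖ ^ 2 - inner ℝ (x - y) (r x - r y) := by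
              rw [← neg_sub (r x) (r y), inner_neg_right, ← real_inner_self_eq_norm_sq,
                neg_add_eq_sub, ← inner_sub_left, ← inner_sub_left]
              congr 1
              abel
            linarith
        _ ≤ ‖x - y‖ * ‖r x - r y‖ := real_inner_le_norm _ _
    rw [dist_eq_norm, dist_eq_norm, NNReal.coe_one, one_mul]
    nlinarith [norm_nonneg (r x - r y), norm_nonneg (x - y)]
  · have hself := hobtuse x x hx
    exact (sub_eq_zero.1 (real_inner_self_nonpos.1 hself)).symm

theorem exists_fixedPoint_of_convex_of_isCompact {E : Type*} [NormedAddCommGroup E]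
    [NormedSpace ℝ E] [FiniteDimensional ℝ E] {s : Set E} (hconv : Convex ℝ s) (hs : IsCompact s)
    (hne : s.Nonempty) {f : E → E} (hf : ContinuousOn f s) (hmaps : Set.MapsTo f s s) :
    ∃ x ∈ s, f x = x := by
  let e := toEuclidean (E := E)
  have hes : IsCompact (e '' s) := hs.image e.continuous
  obtain ⟨r, hr, hrs, hrid⟩ := exists_retraction_of_convex (hne.image e) hes.isComplete
    (hconv.is_linear_image (f := e) ⟨e.map_add, e.map_smul⟩)
  have hrs' : ∀ y, e.symm (r y) ∈ s := fun y => by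
    obtain ⟨x, hx, hxy⟩ := hrs y
    rwa [← hxy, e.symm_apply_apply]
  obtain ⟨R, hR⟩ := hes.isBounded.exists_norm_le
  obtain ⟨y, hy⟩ := exists_fixedPoint_of_continuous_of_norm_le (f := fun y => e (f (e.symm (r y))))
    (e.continuous.comp (hf.comp_continuous (e.symm.continuous.comp hr.continuous) hrs'))
    fun y => hR _ ⟨_, hmaps (hrs' y), rfl⟩
  have hry : r y = y := hrid y (hy ▸ ⟨_, hmaps (hrs' y), rfl⟩)
  rw [hry] at hy
  exact ⟨e.symm y, hry ▸ hrs' y, by rwa [e.eq_symm_apply]⟩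

end Brouwer

namespace NED

/-! ### Probabilistic rounding -/

instance isProbabilityMeasure_roundLaw (x : ℝ) : IsProbabilityMeasure (roundLaw x) := by
  refine ⟨?_⟩
  simp only [roundLaw, Measure.add_apply, Measure.smul_apply, measure_univ, smul_eq_mul, mul_one]
  rw [← ENNReal.ofReal_add (Int.fract_nonneg x) (sub_nonneg.2 (Int.fract_lt_one x).le),
    add_sub_cancel, ENNReal.ofReal_one]

theorem roundLaw_of_nonpos {x : ℝ} (hx : x ≤ 0) : roundLaw x = Measure.dirac 0 := by
  rw [roundLaw, Nat.ceil_eq_zero.2 hx, Nat.floor_of_nonpos hx, ← add_smul,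
    ← ENNReal.ofReal_add (Int.fract_nonneg x) (sub_nonneg.2 (Int.fract_lt_one x).le),
    add_sub_cancel, ENNReal.ofReal_one, one_smul]

theorem ae_roundLaw_ne_zero {x : ℝ} (hx : 1 ≤ x) : ∀ᵐ m ∂roundLaw x, m ≠ 0 := by
  have hfloor : ⌊x⌋₊ ≠ 0 := (Nat.floor_pos.2 hx).ne'
  have hceil : ⌈x⌉₊ ≠ 0 := (Nat.ceil_pos.2 (one_pos.trans_le hx)).ne'
  refine ae_add_measure_iff.2 ⟨Measure.ae_smul_measure ?_ _, Measure.ae_smul_measure ?_ _⟩ <;>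
    simpa only [ae_dirac_eq, Filter.eventually_pure]

theorem integral_roundLaw (x : ℝ) (f : ℕ → ℝ) :
    ∫ m, f m ∂roundLaw x = Int.fract x * f ⌈x⌉₊ + (1 - Int.fract x) * f ⌊x⌋₊ := by
  have hint : ∀ a : ℕ, Integrable f (Measure.dirac a) := fun a => integrable_dirac (by simp)
  rw [roundLaw, integral_add_measure ((hint _).smul_measure ENNReal.ofReal_ne_top)
    ((hint _).smul_measure ENNReal.ofReal_ne_top), integral_smul_measure, integral_smul_measure,
    integral_dirac, integral_dirac, ENNReal.toReal_ofReal (Int.fract_nonneg x),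
    ENNReal.toReal_ofReal (sub_nonneg.2 (Int.fract_lt_one x).le), smul_eq_mul, smul_eq_mul]

theorem integral_roundLaw_of_mem_Icc {n : ℤ} {x : ℝ} (hx : x ∈ Set.Icc (n : ℝ) (n + 1))
    (f : ℕ → ℝ) :
    ∫ m, f m ∂roundLaw x = (n + 1 - x) * f n.toNat + (x - n) * f (n + 1).toNat := by
  rw [integral_roundLaw, ← Int.ceil_toNat, ← Int.floor_toNat]
  rcases eq_or_lt_of_le hx.2 with rfl | hlt
  · simp
  have hfloor : ⌊x⌋ = n := Int.floor_eq_iff.2 ⟨hx.1, hlt⟩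
  rcases eq_or_lt_of_le hx.1 with rfl | hgt
  · simp
  have hceil : ⌈x⌉ = n + 1 := Int.ceil_eq_iff.2 ⟨by simpa using hgt, by simpa using hx.2⟩
  rw [Int.fract, hfloor, hceil]
  ring

theorem locallyFinite_Icc_intCast : LocallyFinite fun n : ℤ => Set.Icc (n : ℝ) (n + 1) := by
  refine fun x => ⟨Set.Ioo (x - 1) (x + 1), Ioo_mem_nhds (sub_one_lt x) (lt_add_one x),
    (Set.finite_Icc (⌊x⌋ - 2) (⌈x⌉ + 1)).subset ?_⟩
  rintro n ⟨y, hny, hyx⟩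
  constructor
  · have hn : ((⌊x⌋ - 2 : ℤ) : ℝ) < n := by
      push_cast
      linarith [Int.floor_le x, hny.2, hyx.1]
    exact (Int.cast_lt.1 hn).le
  · have hn : (n : ℝ) < (⌈x⌉ + 1 : ℤ) := by
      push_cast
      linarith [Int.le_ceil x, hny.1, hyx.2]
    exact (Int.cast_lt.1 hn).le

theorem continuous_integral_roundLaw {X : Type*} [TopologicalSpace X] {x : X → ℝ} {f : ℕ → X → ℝ}
    (hx : Continuous x) (hf : ∀ m, Continuous (f m)) :
    Continuous fun a => ∫ m, f m a ∂roundLaw (x a) := by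
  refine (locallyFinite_Icc_intCast.preimage_continuous hx).continuous ?_
    (fun n => isClosed_Icc.preimage hx) fun n => ?_
  · rw [← Set.preimage_iUnion, iUnion_Icc_intCast, Set.preimage_univ]
  · refine ContinuousOn.congr (f := fun a => (n + 1 - x a) * f n.toNat a +
      (x a - n) * f (n + 1).toNat a) (by fun_prop) fun a ha => ?_
    exact integral_roundLaw_of_mem_Icc ha fun m => f m a

theorem integrable_roundLaw_prod (x y : ℝ) (f : ℕ × ℕ → ℝ) :
    Integrable f ((roundLaw x).prod (roundLaw y)) := by
  have hdirac : ∀ a b : ℕ, Integrable f ((Measure.dirac a).prod (Measure.dirac b)) := fun a b => by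
    rw [Measure.dirac_prod_dirac]
    exact integrable_dirac (by simp)
  simp only [roundLaw, Measure.prod_add, Measure.add_prod, Measure.prod_smul_left,
    Measure.prod_smul_right]
  refine Integrable.add_measure (Integrable.smul_measure ?_ ENNReal.ofReal_ne_top)
    (Integrable.smul_measure ?_ ENNReal.ofReal_ne_top) <;>
    exact ((hdirac _ _).smul_measure ENNReal.ofReal_ne_top).add_measure
      ((hdirac _ _).smul_measure ENNReal.ofReal_ne_top)

theorem integral_roundLaw_prod (x y : ℝ) (f : ℕ → ℕ → ℝ) :
    ∫ s : ℕ × ℕ, f s.1 s.2 ∂((roundLaw x).prod (roundLaw y)) =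
      ∫ m, ∫ n, f m n ∂roundLaw y ∂roundLaw x :=
  integral_prod _ (integrable_roundLaw_prod x y _)

theorem continuous_integral_roundLaw_prod (f : ℕ → ℕ → ℝ) :
    Continuous fun z : ℝ × ℝ =>
      ∫ s : ℕ × ℕ, f s.1 s.2 ∂((roundLaw z.1).prod (roundLaw z.2)) := by
  simp_rw [integral_roundLaw_prod]
  exact continuous_integral_roundLaw continuous_fst fun m =>
    continuous_integral_roundLaw continuous_snd fun n => continuous_const

/-! ### The simulator -/

section Simulator

variable {U : ℕ}

instance finite_packing (m n : ℕ) : Finite (Packing U m n) := inferInstanceAs (Finite (Subtype _))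

instance discreteMeasurableSpace_packing (m n : ℕ) : DiscreteMeasurableSpace (Packing U m n) :=
  ⟨fun _ => trivial⟩

theorem measurable_score (m n : ℕ) : Measurable (score (m := m) (n := n)) :=
  measurable_pi_lambda _ fun r => measurable_pi_lambda _ fun d => by
    unfold score
    fun_prop

instance isProbabilityMeasure_snapshotLaw (m n : ℕ) : IsProbabilityMeasure (snapshotLaw m n) := by
  unfold snapshotLaw
  infer_instance

instance isProbabilityMeasure_outcomeLaw (alg : DispatchAlgorithm U) (m n : ℕ) :
    IsProbabilityMeasure (outcomeLaw alg m n) := by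
  have hmarkov := alg.isMarkov m n
  have hscore := Measure.isProbabilityMeasure_map (μ := snapshotLaw m n)
    (measurable_score m n).aemeasurable
  unfold outcomeLaw
  infer_instance

theorem Packing.sum_count {m n : ℕ} (S : Packing U m n) : ∑ i, S.count i = m := by
  have hfiber := Finset.card_eq_sum_card_fiberwise (s := (univ : Finset (Fin m))) (t := univ)
    (f := fun r => (⟨#(S.1 r), Nat.lt_succ_of_le (S.2.2 r)⟩ : Fin (U + 1))) (by simp)
  simpa [Packing.count, Fin.ext_iff] using hfiber.symm

theorem Packing.count_zero_drivers {m : ℕ} (S : Packing U m 0) (i : Fin (U + 1)) :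
    (S.count i : ℝ) = m * Profile.idle U i := by
  have hcard : ∀ r, #(S.1 r) = 0 := fun r => by simp [Finset.eq_empty_of_isEmpty]
  by_cases hi : i = 0
  · simp [Packing.count, Profile.idle, hcard, hi]
  · have hi' : (0 : ℕ) ≠ i := fun h => hi (Fin.ext h.symm)
    simp [Packing.count, Profile.idle, hcard, hi, hi']

theorem empiricalFreq_mem_stdSimplex {m n K : ℕ} (hK : 0 < K) {qe : Profile U}
    (hqe : qe ∈ stdSimplex ℝ (Fin (U + 1))) (ω : Fin K → Packing U m n) :
    empiricalFreq qe ω ∈ stdSimplex ℝ (Fin (U + 1)) := by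
  rcases eq_or_ne m 0 with rfl | hm
  · exact hqe
  have hcount : ∀ k, ∑ i, ((ω k).count i : ℝ) = m := fun k => by exact_mod_cast (ω k).sum_count
  refine ⟨fun i => ?_, ?_⟩ <;> simp only [empiricalFreq, if_neg hm]
  · positivity
  rw [← Finset.sum_div, Finset.sum_comm, div_eq_one_iff_eq (by positivity)]
  simp [hcount]

theorem empiricalFreq_zero_drivers {m K : ℕ} (hK : 0 < K) {qe : Profile U}
    (hm : m ≠ 0 ∨ qe = Profile.idle U) (ω : Fin K → Packing U m 0) :
    empiricalFreq qe ω = Profile.idle U := by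
  ext i
  by_cases hm0 : m = 0
  · rw [empiricalFreq, if_pos hm0, hm.resolve_left (not_not.2 hm0)]
  · simp only [empiricalFreq, if_neg hm0, Packing.count_zero_drivers, sum_const, card_univ,
      Fintype.card_fin, nsmul_eq_mul]
    field_simp

theorem integral_mem_stdSimplex {ι Ω : Type*} [Fintype ι] [MeasurableSpace Ω] (ν : Measure Ω)
    [IsProbabilityMeasure ν] {X : Ω → ι → ℝ} (hX : ∀ ω, X ω ∈ stdSimplex ℝ ι)
    (hint : ∀ i, Integrable (fun ω => X ω i) ν) :
    (fun i => ∫ ω, X ω i ∂ν) ∈ stdSimplex ℝ ι := by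
  refine ⟨fun i => integral_nonneg fun ω => (hX ω).1 i, ?_⟩
  rw [← integral_finsetSum _ fun i _ => hint i]
  simp [(hX _).2]

variable (alg : DispatchAlgorithm U) {K : ℕ} {qe : Profile U}

theorem expectedFreq_mem_stdSimplex (hK : 0 < K) (hqe : qe ∈ stdSimplex ℝ (Fin (U + 1)))
    (m n : ℕ) : expectedFreq alg K qe m n ∈ stdSimplex ℝ (Fin (U + 1)) :=
  integral_mem_stdSimplex _ (empiricalFreq_mem_stdSimplex hK hqe) fun _ => .of_finite

theorem expectedFreq_zero_drivers (hK : 0 < K) {m : ℕ} (hm : m ≠ 0 ∨ qe = Profile.idle U) :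
    expectedFreq alg K qe m 0 = Profile.idle U := by
  ext i
  simp only [expectedFreq, empiricalFreq_zero_drivers hK hm, integral_const, probReal_univ,
    one_smul]

theorem simulate_mem_stdSimplex (hK : 0 < K) (hqe : qe ∈ stdSimplex ℝ (Fin (U + 1))) (x y : ℝ) :
    simulate alg K qe x y ∈ stdSimplex ℝ (Fin (U + 1)) :=
  integral_mem_stdSimplex _ (fun s : ℕ × ℕ => expectedFreq_mem_stdSimplex alg hK hqe s.1 s.2)
    fun _ => integrable_roundLaw_prod x y _

theorem continuous_simulate (K : ℕ) (qe : Profile U) :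
    Continuous fun z : ℝ × ℝ => simulate alg K qe z.1 z.2 :=
  continuous_pi fun i => continuous_integral_roundLaw_prod fun m n => expectedFreq alg K qe m n i

theorem simulate_of_nonpos_drivers (hK : 0 < K) {x y : ℝ} (hx : 1 ≤ x ∨ qe = Profile.idle U)
    (hy : y ≤ 0) : simulate alg K qe x y = Profile.idle U := by
  ext i
  have hriders : ∀ᵐ m ∂roundLaw x, m ≠ 0 ∨ qe = Profile.idle U :=
    hx.elim (fun hx => (ae_roundLaw_ne_zero hx).mono fun _ => Or.inl)
      fun hqe => .of_forall fun _ => .inr hqe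
  have hidle : ∀ᵐ m ∂roundLaw x,
      ∫ n, expectedFreq alg K qe m n i ∂roundLaw y = Profile.idle U i := by
    filter_upwards [hriders] with m hm
    rw [roundLaw_of_nonpos hy, integral_dirac, expectedFreq_zero_drivers alg hK hm]
  rw [simulate, integral_roundLaw_prod x y fun m n => expectedFreq alg K qe m n i,
    integral_congr_ae hidle, integral_const, probReal_univ, one_smul]

end Simulator

/-! ### The fluid stage -/

section Fluid

variable {U : ℕ}

theorem Profile.continuous_entry (i : ℕ) : Continuous fun q : Profile U => q.entry i := by
  unfold Profile.entry
  split_ifs <;> fun_prop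

theorem Profile.entry_nonneg {q : Profile U} (hq : q ∈ stdSimplex ℝ (Fin (U + 1))) (i : ℕ) :
    0 ≤ q.entry i := by
  unfold Profile.entry
  split_ifs
  exacts [hq.1 _, le_rfl]

theorem Profile.entry_idle {i : ℕ} (hi : i ≠ 0) : (Profile.idle U).entry i = 0 := by
  unfold Profile.entry Profile.idle
  split_ifs with h
  · exact Pi.single_eq_of_ne (fun h0 => hi (congrArg Fin.val h0)) _
  · rfl

theorem Profile.sum_entry_idle_mul {a : ℕ} (ha : a ≠ 0) (b : ℕ) (f : ℕ → ℝ) :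
    ∑ i ∈ Icc a b, (Profile.idle U).entry i * f i = 0 :=
  Finset.sum_eq_zero fun i hi => by
    rw [entry_idle (Nat.ne_zero_of_lt ((Nat.pos_of_ne_zero ha).trans_le (mem_Icc.1 hi).1)),
      zero_mul]

namespace Params

variable {P : Params}

theorem ratioProd_le_one (hP : P.Admissible) (a b : ℕ) : P.ratioProd a b ≤ 1 := by
  have hη := hP.eta_pos
  have hμ := hP.mu_pos
  have hN := hP.etaN_nonneg
  have hc : 0 < P.c := hP.reject_pos
  have hcμ : P.c ≤ P.mu + P.etaN := by
    unfold c
    nlinarith [hP.p_nonneg]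
  refine Finset.prod_le_one (fun j _ => by positivity) fun j _ => ?_
  rw [div_le_one (by positivity)]
  exact (mul_le_mul_of_nonneg_left hcμ j.cast_nonneg).trans (le_add_of_nonneg_left hη.le)

theorem exitRate_pos (hP : P.Admissible) {q : Profile U} (hq : q ∈ stdSimplex ℝ (Fin (U + 1))) :
    0 < P.exitRate q :=
  add_pos_of_pos_of_nonneg hP.eta_pos <| Finset.sum_nonneg fun i _ =>
    mul_nonneg (q.entry_nonneg hq i) (sub_nonneg.2 (ratioProd_le_one hP 1 i))

theorem R0_pos (hP : P.Admissible) {q : Profile U} (hq : q ∈ stdSimplex ℝ (Fin (U + 1))) :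
    0 < P.R0 q :=
  div_pos hP.lam_pos (exitRate_pos hP hq)

theorem continuous_exitRate (P : Params) : Continuous fun q : Profile U => P.exitRate q := by
  have hentry := Profile.continuous_entry (U := U)
  unfold exitRate
  fun_prop

theorem continuousOn_R0 (hP : P.Admissible) :
    ContinuousOn (fun q : Profile U => P.R0 q) (stdSimplex ℝ (Fin (U + 1))) :=
  continuousOn_const.div P.continuous_exitRate.continuousOn fun _ hq => (exitRate_pos hP hq).ne'

theorem continuousOn_DBA (hP : P.Admissible) (l : ℕ) :
    ContinuousOn (fun q : Profile U => P.DBA q l) (stdSimplex ℝ (Fin (U + 1))) := by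
  have hentry := Profile.continuous_entry (U := U)
  refine (continuousOn_R0 hP).mul (Continuous.continuousOn ?_)
  exact continuous_finsetSum _ fun j _ => Continuous.div_const (by fun_prop) _

theorem continuousOn_ABA (hP : P.Admissible) (l : ℕ) :
    ContinuousOn (fun q : Profile U => P.ABA q l) (stdSimplex ℝ (Fin (U + 1))) := by
  have hentry := Profile.continuous_entry (U := U)
  refine (continuousOn_R0 hP).mul (Continuous.continuousOn ?_)
  exact .sub (.div_const (by fun_prop) _)
    (continuous_finsetSum _ fun j _ => Continuous.div_const (by fun_prop) _)

theorem continuousOn_D0FA (hP : P.Admissible) :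
    ContinuousOn (fun q : Profile U => P.D0FA q) (stdSimplex ℝ (Fin (U + 1))) := by
  have hentry := Profile.continuous_entry (U := U)
  refine ((continuousOn_const.sub (.const_mul (.div (Continuous.continuousOn ?_)
    P.continuous_exitRate.continuousOn fun q hq => ?_) _))).div_const _
  · fun_prop
  · exact (exitRate_pos hP hq).ne'

theorem continuousOn_D0BA (hP : P.Admissible) :
    ContinuousOn (fun q : Profile U => P.D0BA q) (stdSimplex ℝ (Fin (U + 1))) := by
  have hD := continuousOn_DBA (U := U) hP
  have hA := continuousOn_ABA (U := U) hP
  have hentry : ∀ l, ContinuousOn (fun q : Profile U => q.entry l) (stdSimplex ℝ (Fin (U + 1))) :=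
    fun l => (Profile.continuous_entry l).continuousOn
  exact (((continuousOn_const.add (continuousOn_finsetSum _ fun l _ => (hD l).mul_const _)).add
    (continuousOn_finsetSum _ fun l _ => (hA l).mul_const _)).sub
    ((continuousOn_R0 hP).mul (continuousOn_finsetSum _ fun l _ =>
      (hentry l).const_mul _))).div_const _

theorem continuousOn_D0 (hP : P.Admissible) (prot : Protocol) :
    ContinuousOn (fun q : Profile U => P.D0 q prot) (stdSimplex ℝ (Fin (U + 1))) := by
  cases prot with
  | firstAccept => exact continuousOn_D0FA hP
  | bestAccept => exact continuousOn_D0BA hP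

theorem DBA_idle (P : Params) {l : ℕ} (hl : l ≠ 0) : P.DBA (Profile.idle U) l = 0 := by
  unfold DBA
  rw [Finset.sum_eq_zero fun j hj => ?_, mul_zero]
  have hj0 : j ≠ 0 := (Nat.pos_of_ne_zero hl |>.trans_le (mem_Icc.1 hj).1).ne'
  have hsum : ∑ i ∈ Icc j U, (Profile.idle U).entry i = 0 := by
    simpa using Profile.sum_entry_idle_mul hj0 U 1
  rw [hsum, mul_zero, zero_div]

theorem ABA_idle (P : Params) {l : ℕ} (hl : 2 ≤ l) : P.ABA (Profile.idle U) l = 0 := by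
  unfold ABA
  rw [Profile.sum_entry_idle_mul (by lia), Finset.sum_eq_zero fun j hj => ?_, zero_div, sub_zero,
    mul_zero]
  have hj0 : j ≠ 0 := by have hlj := (mem_Icc.1 hj).1; lia
  have hsum : ∑ i ∈ Icc j U, (Profile.idle U).entry i = 0 := by
    simpa using Profile.sum_entry_idle_mul hj0 U 1
  rw [hsum, mul_zero, zero_div]

theorem D0_idle (P : Params) (prot : Protocol) :
    P.D0 (Profile.idle U) prot = P.lamD / P.etaI := by
  have hne : ∀ l ∈ Icc 1 U, l ≠ 0 := fun l hl => Nat.one_le_iff_ne_zero.1 (mem_Icc.1 hl).1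
  cases prot with
  | firstAccept =>
    have hsum : ∑ l ∈ Icc 1 U, ∑ i ∈ Icc l U, (Profile.idle U).entry i * P.ratioProd l i = 0 :=
      Finset.sum_eq_zero fun l hl => Profile.sum_entry_idle_mul (hne l hl) U _
    simp [D0, D0FA, hsum]
  | bestAccept =>
    have hD : ∑ l ∈ Icc 1 U, P.DBA (Profile.idle U) l *
        (P.eta + P.mu * (1 - P.p) + ((l : ℝ) - 1) * P.mu * P.p) = 0 :=
      Finset.sum_eq_zero fun l hl => by rw [P.DBA_idle (hne l hl), zero_mul]
    have hA : ∑ l ∈ Icc 2 U, P.ABA (Profile.idle U) l *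
        (P.eta + ((l : ℝ) - 1) * P.mu * P.p) = 0 :=
      Finset.sum_eq_zero fun l hl => by rw [P.ABA_idle (mem_Icc.1 hl).1, zero_mul]
    have hN : ∑ l ∈ Icc 1 U, (l : ℝ) * (Profile.idle U).entry l = 0 :=
      Finset.sum_eq_zero fun l hl => by rw [Profile.entry_idle (hne l hl), mul_zero]
    simp [D0, D0BA, hD, hA, hN]

end Params

end Fluid

theorem continuousOn_iterMap {U : ℕ} {P : Params} (hP : P.Admissible) (prot : Protocol)
    (alg : DispatchAlgorithm U) (K : ℕ) (qe : Profile U) :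
    ContinuousOn (iterMap P prot alg K qe) (stdSimplex ℝ (Fin (U + 1))) := by
  have hsizes : ContinuousOn (fun q => (P.R0 q, P.D0 q prot)) (stdSimplex ℝ (Fin (U + 1))) :=
    (Params.continuousOn_R0 hP).prodMk (Params.continuousOn_D0 hP prot)
  have hcomp := (continuous_simulate alg K qe).comp_continuousOn hsizes
  exact hcomp

end NED

theorem theorem1 (U : ℕ) (P : NED.Params) (hP : P.Admissible) (prot : NED.Protocol)
    (alg : NED.DispatchAlgorithm U) (K : ℕ) (hK : 0 < K)
    (qe : NED.Profile U) (hqe : qe ∈ stdSimplex ℝ (Fin (U + 1))) :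
    Set.MapsTo (NED.iterMap P prot alg K qe)
        (stdSimplex ℝ (Fin (U + 1))) (stdSimplex ℝ (Fin (U + 1))) ∧
      ∃ q ∈ stdSimplex ℝ (Fin (U + 1)),
        NED.iterMap P prot alg K qe q = q ∧
        0 < P.R0 q ∧
        (1 ≤ P.R0 q ∨ qe = NED.Profile.idle U → 0 < P.D0 q prot) := by
  have hmaps : Set.MapsTo (NED.iterMap P prot alg K qe)
      (stdSimplex ℝ (Fin (U + 1))) (stdSimplex ℝ (Fin (U + 1))) := fun q _ =>
    NED.simulate_mem_stdSimplex alg hK hqe (P.R0 q) (P.D0 q prot)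
  obtain ⟨q, hq, hfix⟩ := Brouwer.exists_fixedPoint_of_convex_of_isCompact
    (convex_stdSimplex ℝ _) (isCompact_stdSimplex ℝ _) ⟨qe, hqe⟩
    (NED.continuousOn_iterMap hP prot alg K qe) hmaps
  refine ⟨hmaps, q, hq, hfix, NED.Params.R0_pos hP hq, fun hriders => ?_⟩
  by_contra! hD
  have hidle : q = NED.Profile.idle U :=
    hfix.symm.trans (NED.simulate_of_nonpos_drivers alg hK hriders hD)
  rw [hidle, P.D0_idle] at hD
  exact hD.not_gt (div_pos hP.lamD_pos hP.etaI_pos)
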